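/- Let $\mathfrak c=2^{\aleph_0}$, let $D=\{0,1\}$ be the two-point discrete space, and let $D^{\mathfrak c}$ be the product of $\mathfrak c$ copies of $D$ with the product topology. Call a sequence trivial if it is eventually constant. There is a family $\{Y_\alpha:\alpha<2^{\mathfrak c}\}$ of dense countable subspaces $Y_\alpha\subset D^{\mathfrak c}$ such that: (1) for every $\alpha<2^{\mathfrak c}$, no nontrivial sequence of points of $Y_\alpha$ converges to a point of $D^{\mathfrak c}$; and (2) whenever $\alpha\neq\alpha'$, the spaces $Y_\alpha$ and $Y_{\alpha'}$ (with the subspace topologies) are disjoint and non-homeomorphic. -/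

import Mathlib

open Filter Topology

universe u

/-!
Write `G = J → Bool`, a space of cardinality `2 ^ 𝔠`.

A countable dense `Y ⊆ G` without nontrivial convergent sequences is built on a countable index set
with finite levels. The coordinates `j : J` enumerate both the infinite binary words and the
sequences of indices. The value of an indexed point at `j` is read off from an initial segment of
the `j`-th word, except that it is made to alternate along the `j`-th sequence if the levels of that
sequence increase strictly. A nontrivial convergent sequence would contain such a sequence of
indices, so it fails to converge in some coordinate (`eventually_const_of_range_alternatingPoint`).
The exceptions affect at most one point of each level in each coordinate, too few to destroy density
(`dense_range_alternatingPoint`).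

Adding one point `f` of `G` to `Y` preserves these properties, and for a countable `Z` at most
continuum many `f ∉ Y` make `insert f Y` homeomorphic to `Z`: by density of `Y`, such a
homeomorphism determines `f` through its restriction to `Y`, a map between countable sets
(`mk_setOf_homeomorph_insert_le`). Hence, given fewer than `2 ^ 𝔠` countable sets, a translate of
`Y` misses all of them, and a suitable `f` makes it homeomorphic to none of them while keeping it
disjoint (`exists_disjoint_nonhomeomorphic`). Transfinite recursion of length `2 ^ 𝔠` yields the
family.
-/

/-- A countable dense set `Y` such that every sequence in `Y` that converges in the ambient space is
eventually constant. -/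
structure IsSeqTrivialDense {X : Type*} [TopologicalSpace X] (Y : Set X) : Prop where
  countable : Y.Countable
  dense : Dense Y
  eventually_const : ∀ s : ℕ → X, (∀ n, s n ∈ Y) → (∃ x, Tendsto s atTop (𝓝 x)) →
    ∃ a, ∀ᶠ n in atTop, s n = a

/-! ### A countable dense set without nontrivial convergent sequences -/

/-- The countable index set of the dense set. A point of level `n` is a Boolean function on the
`n`-bit words, together with one of `n` labels; each level is finite. -/
abbrev LevelPoint : Type := Σ n : ℕ, Fin n × ((Fin n → Bool) → Bool)

lemma tendsto_level_cofinite : Tendsto (fun p : LevelPoint => p.1) cofinite atTop := by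
  rw [← Nat.cofinite_eq_atTop]
  refine Tendsto.cofinite_of_finite_preimage_singleton fun n => ?_
  refine (Set.finite_range (Sigma.mk n : _ → LevelPoint)).subset ?_
  rintro ⟨m, q⟩ h
  obtain rfl : m = n := h
  exact ⟨q, rfl⟩

open Classical in
/-- The `j`-th coordinate of the point of `J → Bool` indexed by `p`. Each `j` carries an infinite
binary word `e j` and a sequence `τ j` of indices. The function part of `p` is evaluated at an
initial segment of `e j`, except that along `τ j`, if its levels increase strictly, the coordinate
alternates. -/
noncomputable def alternatingPoint {J : Type*} (e : J → ℕ → Bool) (τ : J → ℕ → LevelPoint)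
    (p : LevelPoint) (j : J) : Bool :=
  if StrictMono (fun k => (τ j k).1) ∧ p ∈ Set.range (τ j) then decide (∃ k, τ j (2 * k) = p)
  else p.2.2 fun i => e j i

section AlternatingPoint

variable {J : Type*} {e : J → ℕ → Bool} {τ : J → ℕ → LevelPoint}

lemma alternatingPoint_even {j : J} (h : StrictMono fun k => (τ j k).1) (k : ℕ) :
    alternatingPoint e τ (τ j (2 * k)) j = true := by
  simp [alternatingPoint, h]

lemma alternatingPoint_odd {j : J} (h : StrictMono fun k => (τ j k).1) (k : ℕ) :
    alternatingPoint e τ (τ j (2 * k + 1)) j = false := by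
  have : ¬ ∃ l, τ j (2 * l) = τ j (2 * k + 1) := by
    rintro ⟨l, hl⟩
    have := h.injective (congrArg Sigma.fst hl)
    omega
  simp [alternatingPoint, h, this]

lemma exists_separating_length (he : Function.Injective e) (F : Finset J) :
    ∃ n₀, ∀ n, n₀ ≤ n → Set.InjOn (fun j (i : Fin n) => e j i) F := by
  have key : ∀ j k : J, ∃ m, j ≠ k → e j m ≠ e k m := by
    intro j k
    by_cases h : j = k
    · exact ⟨0, fun h' => absurd h h'⟩
    · obtain ⟨m, hm⟩ := Function.ne_iff.mp (he.ne h)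
      exact ⟨m, fun _ => hm⟩
  choose m hm using key
  refine ⟨(F ×ˢ F).sup (fun q => m q.1 q.2 + 1), fun n hn j hj k hk hjk => ?_⟩
  by_contra hne
  have hlt : m j k + 1 ≤ n :=
    (Finset.le_sup (f := fun q : J × J => m q.1 q.2 + 1)
      (Finset.mk_mem_product (Finset.mem_coe.mp hj) (Finset.mem_coe.mp hk))).trans hn
  exact hm j k hne (congrFun hjk ⟨m j k, hlt⟩)

/-- At a level exceeding the number of prescribed coordinates, some label avoids all the sequences
attached to those coordinates, since each of them meets the level at most once. -/
lemma exists_alternatingPoint_eq (he : Function.Injective e) (F : Finset J) (ε : J → Bool) :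
    ∃ p, ∀ j ∈ F, alternatingPoint e τ p j = ε j := by
  classical
  obtain ⟨n₀, hn₀⟩ := exists_separating_length he F
  let n := max n₀ (F.card + 1)
  have hinj := hn₀ n (le_max_left _ _)
  let φ : (Fin n → Bool) → Bool := fun w =>
    decide (∃ j ∈ F, (fun i : Fin n => e j i) = w ∧ ε j = true)
  have hφ : ∀ j ∈ F, φ (fun i => e j i) = ε j := by
    intro j hj
    rw [Bool.eq_iff_iff, decide_eq_true_iff]
    constructor
    · rintro ⟨k, hk, hkj, h⟩
      rwa [← hinj hk hj hkj]
    · exact fun h => ⟨j, hj, rfl, h⟩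
  obtain ⟨i, hi⟩ : ∃ i : Fin n, ∀ j ∈ F,
      ¬ (StrictMono (fun k => (τ j k).1) ∧ (⟨n, i, φ⟩ : LevelPoint) ∈ Set.range (τ j)) := by
    by_contra! hcon
    choose g hg hmono hrange using hcon
    have hginj : Function.Injective g := by
      intro a b hab
      obtain ⟨k, hk⟩ := hrange a
      obtain ⟨l, hl⟩ := hrange b
      rw [← hab] at hl
      have hkl : k = l := (hmono a).injective (by simp [hk, hl])
      subst hkl
      have := hk.symm.trans hl
      simpa using this
    have hcard : (Finset.univ.image g).card ≤ F.card :=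
      Finset.card_le_card fun j hj => by
        obtain ⟨a, -, rfl⟩ := Finset.mem_image.mp hj
        exact hg a
    rw [Finset.card_image_of_injective _ hginj, Finset.card_univ, Fintype.card_fin] at hcard
    have : F.card + 1 ≤ n := le_max_right _ _
    omega
  refine ⟨⟨n, i, φ⟩, fun j hj => ?_⟩
  rw [alternatingPoint, if_neg (hi j hj)]
  exact hφ j hj

lemma dense_range_alternatingPoint (he : Function.Injective e) :
    Dense (Set.range (alternatingPoint e τ)) := by
  rw [dense_iff_inter_open]
  rintro U hU ⟨x, hx⟩
  obtain ⟨F, V, hV, hFV⟩ := isOpen_pi_iff.mp hU x hx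
  obtain ⟨p, hp⟩ := exists_alternatingPoint_eq (τ := τ) he F x
  refine ⟨_, hFV fun j hj => ?_, p, rfl⟩
  rw [hp j hj]
  exact (hV j hj).2

/-- A convergent sequence that is not eventually constant has a subsequence along which the levels
of the indices increase strictly; that subsequence alternates in some coordinate. -/
lemma eventually_const_of_range_alternatingPoint (hτ : Function.Surjective τ) (s : ℕ → J → Bool)
    (hs : ∀ n, s n ∈ Set.range (alternatingPoint e τ)) (hx : ∃ x, Tendsto s atTop (𝓝 x)) :
    ∃ a, ∀ᶠ n in atTop, s n = a := by
  obtain ⟨x, hx⟩ := hx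
  refine ⟨x, ?_⟩
  by_contra hne
  rw [not_eventually] at hne
  obtain ⟨a, ha, hax⟩ := extraction_of_frequently_atTop hne
  choose t ht using hs
  have hlim : Tendsto (s ∘ a) atTop (𝓝 x) := hx.comp ha.tendsto_atTop
  -- A value different from the limit is taken only finitely often.
  have hcof : Tendsto (t ∘ a) atTop cofinite := by
    rw [← Nat.cofinite_eq_atTop]
    refine Tendsto.cofinite_of_finite_preimage_singleton fun p => ?_
    by_cases hp : alternatingPoint e τ p = x
    · refine Set.finite_empty.subset fun n hn => hax n ?_
      have hn' : t (a n) = p := hn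
      rw [← ht (a n), hn', hp]
    · have : ∀ᶠ n in atTop, s (a n) ≠ alternatingPoint e τ p :=
        hlim.eventually_ne (Ne.symm hp)
      rw [← Nat.cofinite_eq_atTop, eventually_cofinite] at this
      refine this.subset fun n hn => ?_
      have hn' : t (a n) = p := hn
      simp only [ne_eq, not_not, Set.mem_ofPred_eq]
      rw [← ht (a n), hn']
  obtain ⟨b, hb, hmono⟩ := strictMono_subseq_of_tendsto_atTop (tendsto_level_cofinite.comp hcof)
  obtain ⟨j, hj⟩ := hτ (t ∘ a ∘ b)
  have hj' : StrictMono fun k => (τ j k).1 := by rw [hj]; exact hmono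
  have hlim' : Tendsto (fun n => s (a (b n)) j) atTop (𝓝 (x j)) :=
    (tendsto_pi_nhds.mp hlim j).comp hb.tendsto_atTop
  have hval : ∀ n, s (a (b n)) j = alternatingPoint e τ (τ j n) j := by
    intro n
    rw [hj, ← ht (a (b n))]
    rfl
  rw [nhds_discrete, tendsto_pure] at hlim'
  obtain ⟨n, hn⟩ := eventually_atTop.mp hlim'
  have h0 := hn (2 * n) (by omega)
  have h1 := hn (2 * n + 1) (by omega)
  rw [hval, alternatingPoint_even hj'] at h0
  rw [hval, alternatingPoint_odd hj'] at h1
  exact absurd (h0.trans h1.symm) (by decide)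

end AlternatingPoint

lemma exists_isSeqTrivialDense {J : Type u} (hJ : Cardinal.mk J = Cardinal.continuum) :
    ∃ Y : Set (J → Bool), IsSeqTrivialDense Y := by
  have h1 : Cardinal.lift.{0} (Cardinal.mk J) = Cardinal.lift.{u} (Cardinal.mk (ℕ → Bool)) := by
    simp [hJ]
  have h2 : Cardinal.lift.{0} (Cardinal.mk J)
      = Cardinal.lift.{u} (Cardinal.mk (ℕ → LevelPoint)) := by
    have : Infinite LevelPoint :=
      Infinite.of_injective (fun n : ℕ => (⟨n + 1, 0, fun _ => true⟩ : LevelPoint))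
        fun a b h => by simpa using congrArg Sigma.fst h
    simp [hJ]
  obtain ⟨e⟩ := Cardinal.lift_mk_eq'.mp h1
  obtain ⟨τ⟩ := Cardinal.lift_mk_eq'.mp h2
  exact ⟨Set.range (alternatingPoint e τ), Set.countable_range _,
    dense_range_alternatingPoint e.injective,
    eventually_const_of_range_alternatingPoint τ.surjective⟩

/-! ### Translating the set and adding a point -/

lemma IsSeqTrivialDense.image {X : Type*} [TopologicalSpace X] {Y : Set X}
    (hY : IsSeqTrivialDense Y) (h : X ≃ₜ X) : IsSeqTrivialDense (h '' Y) where
  countable := hY.countable.image h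
  dense := h.surjective.denseRange.dense_image h.continuous hY.dense
  eventually_const := by
    rintro s hs ⟨x, hx⟩
    obtain ⟨a, ha⟩ := hY.eventually_const (fun n => h.symm (s n))
      (fun n => by obtain ⟨y, hy, hyn⟩ := hs n; simpa [← hyn] using hy)
      ⟨h.symm x, (h.symm.continuous.tendsto x).comp hx⟩
    refine ⟨h a, ha.mono fun n hn => ?_⟩
    rw [← hn, h.apply_symm_apply]

lemma IsSeqTrivialDense.insert {X : Type*} [TopologicalSpace X] [T1Space X] {Y : Set X}
    (hY : IsSeqTrivialDense Y) (f : X) : IsSeqTrivialDense (insert f Y) where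
  countable := hY.countable.insert f
  dense := hY.dense.mono (Set.subset_insert _ _)
  eventually_const := by
    rintro s hs ⟨x, hx⟩
    by_cases hfx : f = x
    · subst hfx
      refine ⟨f, ?_⟩
      by_contra hne
      rw [not_eventually] at hne
      obtain ⟨a, ha, hax⟩ := extraction_of_frequently_atTop hne
      have hlim := hx.comp ha.tendsto_atTop
      obtain ⟨c, hc⟩ := hY.eventually_const (s ∘ a) (fun n => (hs (a n)).resolve_left (hax n))
        ⟨f, hlim⟩
      obtain ⟨n, hn, hn'⟩ := (hc.and (hlim.eventually_ne
        (show f ≠ c from fun h => by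
          obtain ⟨n, hn⟩ := hc.exists
          exact hax n (hn.trans h.symm)))).exists
      exact hn' hn
    · obtain ⟨m, hm⟩ := eventually_atTop.mp (hx.eventually_ne (Ne.symm hfx))
      obtain ⟨c, hc⟩ := hY.eventually_const (fun n => s (n + m))
        (fun n => (hs _).resolve_left (hm _ (by omega))) ⟨x, (tendsto_add_atTop_iff_nat m).mpr hx⟩
      obtain ⟨k, hk⟩ := eventually_atTop.mp hc
      refine ⟨c, eventually_atTop.mpr ⟨k + m, fun n hn => ?_⟩⟩
      simpa [Nat.sub_add_cancel (by omega : m ≤ n)] using hk (n - m) (by omega)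

/-- The restriction to `Y` of a homeomorphism from `insert f Y` onto `Z` determines `f`, because
`Y` is dense; and there are at most continuum many maps between countable sets. -/
lemma mk_setOf_homeomorph_insert_le {X : Type u} [TopologicalSpace X] [T2Space X] {Y Z : Set X}
    (hYc : Y.Countable) (hYd : Dense Y) (hZ : Z.Countable) :
    Cardinal.mk {f | f ∉ Y ∧ Nonempty (↥(insert f Y) ≃ₜ Z)} ≤ Cardinal.continuum := by
  let B := {f | f ∉ Y ∧ Nonempty (↥(insert f Y) ≃ₜ Z)}
  let h : ∀ f : B, ↥(insert f.1 Y) ≃ₜ Z := fun f => f.2.2.some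
  let r : B → (Y → Z) := fun f y => h f ⟨y, Set.mem_insert_of_mem _ y.2⟩
  have hr : Function.Injective r := by
    intro f f' hff
    let k : ↥(insert f.1 Y) → X := fun z => ((h f').symm (h f z) : X)
    have hk : Continuous k :=
      continuous_subtype_val.comp ((h f').symm.continuous.comp (h f).continuous)
    have hd : Dense {z : ↥(insert f.1 Y) | (z : X) ∈ Y} := by
      intro z
      rw [closure_subtype]
      refine closure_mono (fun y hy => ?_) (hYd z)
      exact ⟨⟨y, Set.mem_insert_of_mem _ hy⟩, hy, rfl⟩
    have hEq : k = Subtype.val := by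
      refine hk.ext_on hd continuous_subtype_val fun z hz => ?_
      have h1 : h f z = h f' ⟨z, Set.mem_insert_of_mem _ hz⟩ := congrFun hff ⟨z, hz⟩
      simp [k, h1]
    have hmem := ((h f').symm (h f ⟨f.1, Set.mem_insert _ _⟩)).2
    have hkf : ((h f').symm (h f ⟨f.1, Set.mem_insert _ _⟩) : X) = f.1 :=
      congrFun hEq ⟨f.1, Set.mem_insert _ _⟩
    rw [hkf] at hmem
    exact Subtype.ext (hmem.resolve_right f.2.1)
  calc Cardinal.mk B ≤ Cardinal.mk (Y → Z) := Cardinal.mk_le_of_injective hr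
    _ = Cardinal.mk Z ^ Cardinal.mk Y := by simp
    _ ≤ Cardinal.aleph0 ^ Cardinal.mk Y :=
        Cardinal.power_le_power_right (Cardinal.mk_le_aleph0_iff.mpr hZ.to_subtype)
    _ ≤ Cardinal.aleph0 ^ Cardinal.aleph0 :=
        Cardinal.power_le_power_left Cardinal.aleph0_ne_zero
          (Cardinal.mk_le_aleph0_iff.mpr hYc.to_subtype)
    _ = Cardinal.continuum := Cardinal.aleph0_power_aleph0

/-- Translation by `g` in the Boolean group `J → Bool`. -/
def xorHomeomorph {J : Type*} (g : J → Bool) : (J → Bool) ≃ₜ (J → Bool) where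
  toFun x j := xor (g j) (x j)
  invFun x j := xor (g j) (x j)
  left_inv x := by ext; simp
  right_inv x := by ext; simp
  continuous_toFun := continuous_pi fun j =>
    (continuous_of_discreteTopology (f := xor (g j))).comp (continuous_apply j)
  continuous_invFun := continuous_pi fun j =>
    (continuous_of_discreteTopology (f := xor (g j))).comp (continuous_apply j)

/-! ### The family of subspaces -/

lemma exists_disjoint_nonhomeomorphic {J : Type u} (hJ : Cardinal.mk J = Cardinal.continuum)
    (𝒲 : Set (Set (J → Bool))) (h𝒲 : ∀ W ∈ 𝒲, W.Countable)
    (hcard : Cardinal.mk 𝒲 < 2 ^ Cardinal.continuum.{u}) :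
    ∃ Z, IsSeqTrivialDense Z ∧ ∀ W ∈ 𝒲, Disjoint W Z ∧ IsEmpty (W ≃ₜ Z) := by
  obtain ⟨Y, hY⟩ := exists_isSeqTrivialDense hJ
  have hG : Cardinal.mk (J → Bool) = 2 ^ Cardinal.continuum.{u} := by simp [hJ]
  have hc : Cardinal.continuum.{u} < 2 ^ Cardinal.continuum.{u} := Cardinal.cantor _
  have hω : Cardinal.aleph0.{u} < 2 ^ Cardinal.continuum.{u} :=
    Cardinal.aleph0_lt_continuum.trans hc
  have hU : Cardinal.mk (⋃₀ 𝒲) < 2 ^ Cardinal.continuum.{u} := by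
    refine (Cardinal.mk_sUnion_le 𝒲).trans_lt ?_
    refine (mul_le_mul_right (ciSup_le' fun W => ?_) _).trans_lt
      (Cardinal.mul_lt_of_lt hω.le hcard hω)
    exact Cardinal.mk_le_aleph0_iff.mpr (h𝒲 W W.2).to_subtype
  have hYω : Cardinal.mk Y ≤ Cardinal.aleph0 :=
    Cardinal.mk_le_aleph0_iff.mpr hY.countable.to_subtype
  obtain ⟨g, hg⟩ : ∃ g, g ∉ Set.image2 (fun u y j => xor (u j) (y j)) (⋃₀ 𝒲) Y := by
    by_contra! hall
    have h1 : Cardinal.mk (J → Bool) ≤ Cardinal.mk (⋃₀ 𝒲) * Cardinal.mk Y := by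
      rw [← Cardinal.mk_univ, ← Set.eq_univ_of_forall hall]
      exact Cardinal.mk_image2_le
    rw [hG] at h1
    exact absurd h1 (Cardinal.mul_lt_of_lt hω.le hU (hYω.trans_lt hω)).not_ge
  let Y' := xorHomeomorph g '' Y
  have hY' : IsSeqTrivialDense Y' := hY.image _
  have hdisj : ∀ W ∈ 𝒲, Disjoint W Y' := by
    intro W hW
    rw [Set.disjoint_left]
    rintro _ hxW ⟨y, hy, rfl⟩
    refine hg ⟨_, ⟨W, hW, hxW⟩, y, hy, ?_⟩
    ext j
    simp [xorHomeomorph]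
  let bad : Set (J → Bool) :=
    (⋃₀ 𝒲 ∪ Y') ∪ ⋃ W : 𝒲, {f | f ∉ Y' ∧ Nonempty (↥(insert f Y') ≃ₜ W.1)}
  have hbad : Cardinal.mk bad < 2 ^ Cardinal.continuum.{u} := by
    refine (Cardinal.mk_union_le _ _).trans_lt (Cardinal.add_lt_of_lt hω.le ?_ ?_)
    · refine (Cardinal.mk_union_le _ _).trans_lt (Cardinal.add_lt_of_lt hω.le hU ?_)
      exact (Cardinal.mk_le_aleph0_iff.mpr hY'.countable.to_subtype).trans_lt hω
    · refine (Cardinal.mk_iUnion_le _).trans_lt ?_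
      refine (mul_le_mul_right (ciSup_le' fun W => ?_) _).trans_lt
        (Cardinal.mul_lt_of_lt hω.le hcard hc)
      exact mk_setOf_homeomorph_insert_le hY'.countable hY'.dense (h𝒲 W W.2)
  obtain ⟨f, hf⟩ : ∃ f, f ∉ bad := by
    by_contra! hall
    rw [Set.eq_univ_of_forall hall, Cardinal.mk_univ, hG] at hbad
    exact lt_irrefl _ hbad
  refine ⟨insert f Y', hY'.insert f, fun W hW => ⟨?_, ⟨fun φ => hf ?_⟩⟩⟩
  · rw [Set.disjoint_insert_right]
    exact ⟨fun h => hf (Or.inl (Or.inl ⟨W, hW, h⟩)), hdisj W hW⟩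
  · exact Or.inr (Set.mem_iUnion.mpr ⟨⟨W, hW⟩, fun h => hf (Or.inl (Or.inr h)), ⟨φ.symm⟩⟩)

/-- Transfinite choice: each term may be chosen to be related to all the earlier ones. -/
lemma exists_forall_lt_of_forall_exists {ι S : Type*} [Preorder ι] [WellFoundedLT ι]
    {R : S → S → Prop} (h : ∀ (i : ι) (Z : Set.Iio i → S), ∃ z, ∀ j, R (Z j) z) :
    ∃ Z : ι → S, ∀ i j, i < j → R (Z i) (Z j) := by
  choose z hz using h
  let Z : ι → S := WellFoundedLT.fix fun i prev => z i fun j => prev j.1 j.2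
  refine ⟨Z, fun i j hij => ?_⟩
  have hZj : Z j = z j fun k => Z k.1 := WellFoundedLT.fix_eq _ j
  rw [hZj]
  exact hz j (fun k => Z k.1) ⟨i, hij⟩

theorem mainTheorem4 {J : Type u} (hJ : Cardinal.mk J = Cardinal.continuum) :
    ∃ Y : Set.Iio ((2 : Cardinal.{u}) ^ Cardinal.continuum.{u}).ord → Set (J → Bool),
      (∀ α, (Y α).Countable ∧ Dense (Y α)) ∧
      (∀ α, ∀ s : ℕ → (J → Bool), (∀ n, s n ∈ Y α) →
        (∃ x : J → Bool, Tendsto s atTop (𝓝 x)) →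
        ∃ a : J → Bool, ∀ᶠ n in atTop, s n = a) ∧
      (∀ α β, α ≠ β → Disjoint (Y α) (Y β) ∧ IsEmpty (Y α ≃ₜ Y β)) := by
  obtain ⟨Z, hZ⟩ := exists_forall_lt_of_forall_exists
    (ι := Set.Iio ((2 : Cardinal.{u}) ^ Cardinal.continuum.{u}).ord)
    (S := {Z : Set (J → Bool) // IsSeqTrivialDense Z})
    (R := fun W Z => Disjoint W.1 Z.1 ∧ IsEmpty (W.1 ≃ₜ Z.1)) (by
      intro i Z
      have hcard : Cardinal.mk (Set.range fun j => (Z j).1) < 2 ^ Cardinal.continuum.{u} := by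
        rw [← Cardinal.lift_lt.{u, u + 1}]
        refine Cardinal.mk_range_le_lift.trans_lt ?_
        have h1 : Cardinal.mk (Set.Iio i) ≤ Cardinal.mk (Set.Iio i.1) :=
          Cardinal.mk_le_of_injective (f := fun j => ⟨j.1.1, j.2⟩) fun a b h =>
            Subtype.ext (Subtype.ext (congrArg (fun x : Set.Iio i.1 => x.1) h))
        rw [Cardinal.lift_id'.{u, u + 1}]
        refine h1.trans_lt ?_
        rw [Cardinal.mk_Iio_ordinal, Cardinal.lift_lt]
        exact Cardinal.lt_ord.mp i.2
      obtain ⟨z, hz, hR⟩ := exists_disjoint_nonhomeomorphic hJ _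
        (by rintro _ ⟨j, rfl⟩; exact (Z j).2.countable) hcard
      exact ⟨⟨z, hz⟩, fun j => hR _ ⟨j, rfl⟩⟩)
  refine ⟨fun α => (Z α).1, fun α => ⟨(Z α).2.countable, (Z α).2.dense⟩,
    fun α => (Z α).2.eventually_const, fun α β hne => ?_⟩
  rcases hne.lt_or_gt with h | h
  · exact hZ α β h
  · exact ⟨(hZ β α h).1.symm, ⟨fun φ => (hZ β α h).2.false φ.symm⟩⟩
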